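/- Let $V_0,V_1$ be the operators on $L^2(\mathbb T^2)$ given by multiplication by the two coordinate functions, $(V_kf)(\zeta_0,\zeta_1)=\zeta_k f(\zeta_0,\zeta_1)$, $k=0,1$, and put $e_{ij}(\zeta_0,\zeta_1)=\zeta_0^i\zeta_1^j$ for $i,j\in\mathbb Z$. For $\Gamma\subset\mathbb Z^2$ let $H_\Gamma$ be the closed linear span of $\{e_{ij}:(i,j)\in\Gamma\}$. Let $\Gamma$ and $\Gamma'$ be nonempty proper subsets of $\mathbb Z^2$ such that $H_\Gamma$ and $H_{\Gamma'}$ are invariant under $V_0$ and $V_1$ (equivalently, $\Gamma+\mathbb N^2\subset\Gamma$ and $\Gamma'+\mathbb N^2\subset\Gamma'$, where $0\in\mathbb N$). (1) The pairs $(V_0|H_\Gamma,V_1|H_\Gamma)$ and $(V_0|H_{\Gamma'},V_1|H_{\Gamma'})$ are unitarily equivalent, that is, there is a unitary operator $U:H_\Gamma\to H_{\Gamma'}$ with $U(V_k|H_\Gamma)=(V_k|H_{\Gamma'})U$ for $k=0,1$, if and only if $\Gamma'=\Gamma+\gamma$ for some $\gamma\in\mathbb Z^2$. (2) The pair $(V_0|H_\Gamma,V_1|H_\Gamma)$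 is reducible, that is, there is a closed subspace $M$ of $H_\Gamma$, different from $\{0\}$ and $H_\Gamma$, such that $M$ and $H_\Gamma\ominus M$ are both invariant under $V_0$ and $V_1$, if and only if $\Gamma=\Gamma+\gamma$ for some $\gamma\in\mathbb Z^2\setminus\{(0,0)\}$. -/

import Mathlib

open MeasureTheory

noncomputable section

/-- A family of commuting isometric operators on a complex inner product space, indexed by `ι`. -/
structure CommutingIsometries (ι H : Type*) [NormedAddCommGroup H] [InnerProductSpace ℂ H] where
  op : ι → H →ₗᵢ[ℂ] H
  commute : ∀ i j x, op i (op j x) = op j (op i x)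

namespace CommutingIsometries

variable {ι H K : Type*} [NormedAddCommGroup H] [InnerProductSpace ℂ H]
  [NormedAddCommGroup K] [InnerProductSpace ℂ K]

/-- `M` is invariant for the family `V`: each operator of the family maps `M` into `M`. -/
def IsInvariant (V : CommutingIsometries ι H) (M : Submodule ℂ H) : Prop :=
  ∀ i, ∀ x ∈ M, V.op i x ∈ M

/-- `M` is a reducing (closed) subspace for `V`: `M` and its orthogonal complement are invariant. -/
def IsReducing (V : CommutingIsometries ι H) (M : Submodule ℂ H) : Prop :=
  IsClosed (M : Set H) ∧ V.IsInvariant M ∧ V.IsInvariant Mᗮ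

/-- `V` has no reducing subspaces other than `{0}` and the whole space. -/
def IsIrreducible (V : CommutingIsometries ι H) : Prop :=
  ∀ M : Submodule ℂ H, V.IsReducing M → M = ⊥ ∨ M = ⊤

/-- `V` has a reducing subspace different from `{0}` and from the whole space. -/
def IsReducible (V : CommutingIsometries ι H) : Prop :=
  ¬ V.IsIrreducible

/-- The restriction of the family `V` to an invariant subspace `M`. -/
def restrict (V : CommutingIsometries ι H) (M : Submodule ℂ H) (hM : V.IsInvariant M) :
    CommutingIsometries ι M where
  op i :=
    { toLinearMap := (V.op i).toLinearMap.restrict (hM i)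
      norm_map' := fun x => (V.op i).norm_map x }
  commute i j x := Subtype.ext (V.commute i j x)

/-- Two families are unitarily equivalent if a unitary operator (a surjective linear isometry)
intertwines them. -/
def UnitarilyEquivalent (V : CommutingIsometries ι H) (W : CommutingIsometries ι K) : Prop :=
  ∃ U : H ≃ₗᵢ[ℂ] K, ∀ i x, U (V.op i x) = W.op i (U x)

end CommutingIsometries

/-- The torus `𝕋²`. As in Mathlib, the circle is written `ℝ / ℤ`; the point `x` of `ℝ / ℤ` stands
for the complex number `exp (2 π i x)` of modulus one (see `torusCoord`). -/
abbrev Torus2 : Type := UnitAddTorus (Fin 2)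

/-- Normalized Lebesgue (Haar) measure on the torus. -/
abbrev torusMeasure : Measure Torus2 := Measure.pi fun _ => AddCircle.haarAddCircle

/-- The Hilbert space `L²(𝕋²)`. -/
abbrev L2Torus : Type := Lp ℂ 2 torusMeasure

/-- The coordinate function `ζ_k` on the torus, with values in the unit circle of `ℂ`. -/
def torusCoord (k : Fin 2) (x : Torus2) : Circle := AddCircle.toCircle (x k)

theorem continuous_torusCoord (k : Fin 2) : Continuous (torusCoord k) :=
  AddCircle.continuous_toCircle.comp (continuous_apply k)

theorem continuous_torusCoord_coe (k : Fin 2) : Continuous fun x => (torusCoord k x : ℂ) :=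
  continuous_subtype_val.comp (continuous_torusCoord k)

theorem memLp_torusCoord_mul (k : Fin 2) (f : L2Torus) :
    MemLp (fun x => (torusCoord k x : ℂ) * f x) 2 torusMeasure := by
  refine (Lp.memLp f).of_le
    ((continuous_torusCoord_coe k).aestronglyMeasurable.mul
      (Lp.aestronglyMeasurable f)) (Filter.Eventually.of_forall fun x => ?_)
  simp [Circle.norm_coe]

/-- Multiplication by the coordinate function `ζ_k` on `L²(𝕋²)`. -/
def coordMul (k : Fin 2) : L2Torus →ₗᵢ[ℂ] L2Torus where
  toFun f := (memLp_torusCoord_mul k f).toLp _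
  map_add' f g := by
    apply Lp.ext
    filter_upwards [(memLp_torusCoord_mul k (f + g)).coeFn_toLp,
      (memLp_torusCoord_mul k f).coeFn_toLp, (memLp_torusCoord_mul k g).coeFn_toLp,
      Lp.coeFn_add f g, Lp.coeFn_add ((memLp_torusCoord_mul k f).toLp _)
        ((memLp_torusCoord_mul k g).toLp _)] with x h1 h2 h3 h4 h5
    rw [h1, h5, Pi.add_apply, h2, h3, h4, Pi.add_apply, mul_add]
  map_smul' c f := by
    apply Lp.ext
    filter_upwards [(memLp_torusCoord_mul k (c • f)).coeFn_toLp,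
      (memLp_torusCoord_mul k f).coeFn_toLp, Lp.coeFn_smul c f,
      Lp.coeFn_smul c ((memLp_torusCoord_mul k f).toLp _)] with x h1 h2 h3 h4
    rw [h1, RingHom.id_apply, h4, Pi.smul_apply, h2, h3, Pi.smul_apply, smul_eq_mul, smul_eq_mul,
      mul_left_comm]
  norm_map' f := by
    change ‖(memLp_torusCoord_mul k f).toLp _‖ = ‖f‖
    rw [Lp.norm_toLp, Lp.norm_def]
    congr 1
    exact eLpNorm_congr_norm_ae (Filter.Eventually.of_forall fun x => by simp [Circle.norm_coe])

theorem coordMul_coeFn (k : Fin 2) (f : L2Torus) :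
    coordMul k f =ᵐ[torusMeasure] fun x => (torusCoord k x : ℂ) * f x :=
  (memLp_torusCoord_mul k f).coeFn_toLp

/-- The bi-isometry `(V₀, V₁)` on `L²(𝕋²)` given by multiplication by the two coordinates. -/
def coordBiIsometry : CommutingIsometries (Fin 2) L2Torus where
  op := coordMul
  commute i j f := by
    apply Lp.ext
    filter_upwards [coordMul_coeFn i (coordMul j f), coordMul_coeFn j f,
      coordMul_coeFn j (coordMul i f), coordMul_coeFn i f] with x h1 h2 h3 h4
    rw [h1, h2, h3, h4, mul_left_comm]

/-- The monomial `ζ₀ ^ i * ζ₁ ^ j`, as a continuous function on the torus. -/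
def torusMonomial (g : ℤ × ℤ) : C(Torus2, ℂ) where
  toFun x := (torusCoord 0 x : ℂ) ^ g.1 * (torusCoord 1 x : ℂ) ^ g.2
  continuous_toFun :=
    ((continuous_torusCoord_coe 0).zpow₀ g.1
        fun x => Or.inl (torusCoord 0 x).coe_ne_zero).mul
      ((continuous_torusCoord_coe 1).zpow₀ g.2
        fun x => Or.inl (torusCoord 1 x).coe_ne_zero)

/-- The basis vector `e_{ij}` of `L²(𝕋²)`, for `g = (i, j)`. -/
def torusBasisVec (g : ℤ × ℤ) : L2Torus :=
  ContinuousMap.toLp 2 torusMeasure ℂ (torusMonomial g)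

/-- The space `H_Γ`: the closed linear span of the `e_{ij}` with `(i, j) ∈ Γ`. -/
def spanSpace (Γ : Set (ℤ × ℤ)) : Submodule ℂ L2Torus :=
  (Submodule.span ℂ (torusBasisVec '' Γ)).topologicalClosure

end

/-!
The matrix entries at `(g + γ, g)` of an operator that intertwines two families of translations do
not depend on `g`, because the steps generate the group. If the adjoint intertwines as well and one
of these entries is nonzero, then none of them vanishes, which forces `Γ' = Γ + γ`; conversely a
translation of the index sets induces a unitary intertwiner.

A family is irreducible if and only if its commutant, a von Neumann algebra, is scalar. When
`Γ = Γ + γ` with `γ ≠ 0`, the translation by `γ` is a unitary in the commutant that is not scalar.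
When there is no such `γ`, every operator in the commutant is diagonal with constant diagonal.
-/

open scoped InnerProductSpace ComplexStarModule InnerProduct

/-! ### The commutant -/

namespace CommutingIsometries

section Commutant

variable {ι H K : Type*} [NormedAddCommGroup H] [InnerProductSpace ℂ H]
  [NormedAddCommGroup K] [InnerProductSpace ℂ K]

/-- The operator `A` intertwines the families `V` and `W`. A unitary equivalence is a unitary
intertwiner; the commutant consists of the intertwiners of `V` with itself whose adjoint is also
one. -/
def Intertwines (V : CommutingIsometries ι H) (W : CommutingIsometries ι K) (A : H →L[ℂ] K) :
    Prop :=
  ∀ i x, A (V.op i x) = W.op i (A x)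

variable {V : CommutingIsometries ι H} {W : CommutingIsometries ι K} {M : Submodule ℂ H}
  {S T : H →L[ℂ] H}

theorem intertwines_iff_commute :
    V.Intertwines V T ↔ ∀ i, Commute T (V.op i).toContinuousLinearMap :=
  forall_congr' fun i => (ContinuousLinearMap.ext_iff
    (f := T * (V.op i).toContinuousLinearMap) (g := (V.op i).toContinuousLinearMap * T)).symm

variable [CompleteSpace H]

theorem intertwines_adjoint [CompleteSpace K] {U : H ≃ₗᵢ[ℂ] K} (hU : V.Intertwines W U) :
    W.Intertwines V ((U : H →L[ℂ] K)†) := fun i x => by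
  rw [U.adjoint_eq_symm]
  exact Function.Semiconj.inverse_left (hU i) U.symm_apply_apply U.apply_symm_apply x

/-- The commutant of `V`: the von Neumann algebra of the operators that commute with each
isometry of the family and with its adjoint. -/
noncomputable def commutant (V : CommutingIsometries ι H) : StarSubalgebra ℂ (H →L[ℂ] H) :=
  StarSubalgebra.centralizer ℂ (Set.range fun i => (V.op i).toContinuousLinearMap)

theorem mem_commutant_iff :
    T ∈ V.commutant ↔ V.Intertwines V T ∧ V.Intertwines V (T†) := by
  simp only [commutant, StarSubalgebra.mem_centralizer_iff, Set.forall_mem_range,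
    intertwines_iff_commute, ← forall_and]
  refine forall_congr' fun i => and_congr eq_comm ?_
  rw [← star_inj, star_mul, star_mul, star_star]
  rfl

theorem mem_commutant_of_isSelfAdjoint (hT : IsSelfAdjoint T) (hVT : V.Intertwines V T) :
    T ∈ V.commutant :=
  mem_commutant_iff.2 ⟨hVT, hT.adjoint_eq.symm ▸ hVT⟩

theorem isReducing_ker (hT : T ∈ V.commutant) : V.IsReducing T.ker := by
  obtain ⟨hVT, hVT'⟩ := mem_commutant_iff.1 hT
  refine ⟨T.isClosed_ker, fun i x hx => ?_, fun i x hx => ?_⟩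
  · have hTx : T x = 0 := hx
    simp [hVT i x, hTx]
  · rw [ContinuousLinearMap.orthogonal_ker] at hx ⊢
    refine map_mem_closure (V.op i).continuous hx ?_
    rintro _ ⟨y, rfl⟩
    exact ⟨V.op i y, hVT' i y⟩

theorem starProjection_mem_commutant [M.HasOrthogonalProjection] (hM : V.IsReducing M) :
    M.starProjection ∈ V.commutant := by
  refine mem_commutant_of_isSelfAdjoint (isSelfAdjoint_starProjection M)
    (intertwines_iff_commute.2 fun i => ?_)
  rw [ContinuousLinearMap.IsIdempotentElem.commute_iff M.isIdempotentElem_starProjection,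
    M.range_starProjection, M.ker_starProjection]
  exact ⟨hM.2.1 i, hM.2.2 i⟩

theorem IsIrreducible.eq_zero_or_eq_zero_of_mul_eq_zero (hV : V.IsIrreducible)
    (hS : S ∈ V.commutant) (hST : S * T = 0) : S = 0 ∨ T = 0 := by
  have hker : ∀ x, T x ∈ S.ker := fun x => DFunLike.congr_fun hST x
  rcases hV _ (isReducing_ker hS) with hbot | htop
  · refine .inr (ContinuousLinearMap.ext fun x => ?_)
    simpa [hbot] using hker x
  · refine .inl (ContinuousLinearMap.ext fun x => ?_)
    exact LinearMap.mem_ker.1 (htop ▸ Submodule.mem_top)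

theorem posPart_mem_commutant (hS : S ∈ V.commutant) : S⁺ ∈ V.commutant :=
  mem_commutant_of_isSelfAdjoint (.of_nonneg (CFC.posPart_nonneg S)) <|
    intertwines_iff_commute.2 fun i =>
      (intertwines_iff_commute.1 (mem_commutant_iff.1 hS).1 i).cfcₙ_real (·⁺)

theorem IsIrreducible.nonneg_or_nonpos (hV : V.IsIrreducible) (hS : S ∈ V.commutant)
    (hSsa : IsSelfAdjoint S) : 0 ≤ S ∨ S ≤ 0 := by
  rw [← CFC.negPart_eq_zero_iff S, ← CFC.posPart_eq_zero_iff S, or_comm]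
  exact hV.eq_zero_or_eq_zero_of_mul_eq_zero (posPart_mem_commutant hS)
    (CFC.posPart_mul_negPart S)

theorem IsIrreducible.spectrum_subsingleton (hV : V.IsIrreducible) (hS : S ∈ V.commutant)
    (hSsa : IsSelfAdjoint S) : (spectrum ℝ S).Subsingleton := by
  by_contra h
  obtain ⟨a, ha, b, hb, hab⟩ := (Set.not_subsingleton_iff.1 h).exists_lt
  obtain ⟨m, ham, hmb⟩ := exists_between hab
  have hm : algebraMap ℝ (H →L[ℂ] H) m ∈ V.commutant := V.commutant.algebraMap_mem (m : ℂ)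
  rcases hV.nonneg_or_nonpos (sub_mem hS hm) (hSsa.sub (.algebraMap _ (.all m))) with h | h
  · exact ham.not_ge ((algebraMap_le_iff_le_spectrum hSsa).1 (sub_nonneg.1 h) a ha)
  · exact hmb.not_ge ((le_algebraMap_iff_spectrum_le hSsa).1 (sub_nonpos.1 h) b hb)

theorem IsIrreducible.mem_bot_of_isSelfAdjoint (hV : V.IsIrreducible) (hS : S ∈ V.commutant)
    (hSsa : IsSelfAdjoint S) : S ∈ (⊥ : StarSubalgebra ℂ (H →L[ℂ] H)) := by
  obtain ⟨r, hr⟩ : ∃ r, spectrum ℝ S ⊆ {r} := by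
    rcases (hV.spectrum_subsingleton hS hSsa).eq_empty_or_singleton with h | ⟨r, h⟩
    · exact ⟨0, h ▸ Set.empty_subset _⟩
    · exact ⟨r, h.subset⟩
  rw [CFC.eq_algebraMap_of_spectrum_subset_singleton S r hr]
  exact ⟨r, rfl⟩

theorem IsIrreducible.commutant_eq_bot (hV : V.IsIrreducible) : V.commutant = ⊥ := by
  refine eq_bot_iff.2 fun T hT => ?_
  have hre : (ℜ T : H →L[ℂ] H) ∈ V.commutant := by
    rw [realPart_apply_coe]
    exact V.commutant.smul_mem (add_mem hT (star_mem hT)) ((2⁻¹ : ℝ) : ℂ)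
  have him : (ℑ T : H →L[ℂ] H) ∈ V.commutant := by
    rw [imaginaryPart_apply_coe]
    exact V.commutant.smul_mem
      (V.commutant.smul_mem (sub_mem hT (star_mem hT)) ((2⁻¹ : ℝ) : ℂ)) (-Complex.I)
  rw [← realPart_add_I_smul_imaginaryPart T]
  exact add_mem (hV.mem_bot_of_isSelfAdjoint hre (ℜ T).2)
    (SMulMemClass.smul_mem Complex.I (hV.mem_bot_of_isSelfAdjoint him (ℑ T).2))

theorem isIrreducible_of_commutant_eq_bot (hV : V.commutant = ⊥) : V.IsIrreducible := by
  intro M hM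
  have : CompleteSpace M := hM.1.completeSpace_coe
  obtain ⟨c, hc⟩ : M.starProjection ∈ (⊥ : StarSubalgebra ℂ (H →L[ℂ] H)) :=
    hV ▸ starProjection_mem_commutant hM
  have hPx : ∀ x, M.starProjection x = c • x := fun x => by
    rw [← hc]
    rfl
  refine or_iff_not_imp_left.2 fun hbot => eq_top_iff.2 fun x _ => ?_
  obtain ⟨y, hyM, hy⟩ := M.ne_bot_iff.1 hbot
  have hcy : c • y = (1 : ℂ) • y := by
    rw [← hPx, one_smul, Submodule.starProjection_eq_self_iff.2 hyM]
  rw [← Submodule.starProjection_eq_self_iff, hPx, smul_left_injective ℂ hy hcy, one_smul]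

end Commutant

end CommutingIsometries

/-! ### Translations of a Hilbert basis -/

theorem exists_add_closure_eq_add_closure {G : Type*} [AddCommGroup G] {s : Set G}
    (hs : AddSubgroup.closure s = ⊤) (g g' : G) :
    ∃ m ∈ AddSubmonoid.closure s, ∃ m' ∈ AddSubmonoid.closure s, g + m = g' + m' := by
  have h : g' - g ∈ AddSubmonoid.closure s ⊔ AddSubmonoid.closure (-s) := by
    rw [← AddSubmonoid.closure_union, ← AddSubgroup.closure_toAddSubmonoid, hs]
    trivial
  obtain ⟨m, hm, n, hn, hmn⟩ := AddSubmonoid.mem_sup.1 h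
  refine ⟨m, hm, -n, (AddSubmonoid.mem_closure_neg _ _).1 hn, ?_⟩
  rw [← sub_eq_add_neg, eq_sub_iff_add_eq, add_assoc, hmn, add_sub_cancel]

theorem eq_of_forall_add_eq {G α : Type*} [AddCommGroup G] {s : Set G}
    (hs : AddSubgroup.closure s = ⊤) {Γ : Set G} (hΓ : ∀ t ∈ s, ∀ g ∈ Γ, g + t ∈ Γ) {F : G → α}
    (hF : ∀ t ∈ s, ∀ g ∈ Γ, F (g + t) = F g) {g g' : G} (hg : g ∈ Γ) (hg' : g' ∈ Γ) :
    F g = F g' := by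
  have hadd : ∀ m ∈ AddSubmonoid.closure s, ∀ g ∈ Γ, g + m ∈ Γ ∧ F (g + m) = F g := by
    intro m hm
    induction hm using AddSubmonoid.closure_induction with
    | mem t ht => exact fun g hg => ⟨hΓ t ht g hg, hF t ht g hg⟩
    | zero => simp
    | add m n _ _ ihm ihn =>
      intro g hg
      obtain ⟨hgm, hFm⟩ := ihm g hg
      rw [← add_assoc, ← hFm]
      exact ihn _ hgm
  obtain ⟨m, hm, m', hm', h⟩ := exists_add_closure_eq_add_closure hs g g'
  rw [← (hadd m hm g hg).2, h, (hadd m' hm' g' hg').2]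

theorem eq_image_add_right_iff {G : Type*} [AddGroup G] {Γ Γ' : Set G} {γ : G} :
    Γ' = (fun g => g + γ) '' Γ ↔ ∀ g, g + γ ∈ Γ' ↔ g ∈ Γ := by
  rw [Set.image_add_right, Set.ext_iff, (Equiv.addRight γ).surjective.forall]
  simp only [Equiv.coe_addRight, Set.mem_preimage, add_neg_cancel_right]

section HilbertBasis

variable {α β 𝕜 E F : Type*} [RCLike 𝕜] [NormedAddCommGroup E] [InnerProductSpace 𝕜 E]
  [NormedAddCommGroup F] [InnerProductSpace 𝕜 F]

theorem ext_hilbertBasis (b : HilbertBasis α 𝕜 E) {A B : E →L[𝕜] F}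
    (h : ∀ a, A (b a) = B (b a)) : A = B :=
  ContinuousLinearMap.ext_on (Submodule.dense_iff_topologicalClosure_eq_top.2 b.dense_span)
    (Set.forall_mem_range.2 h)

theorem ext_inner_hilbertBasis (b : HilbertBasis α 𝕜 E) {x y : E}
    (h : ∀ a, ⟪b a, x⟫_𝕜 = ⟪b a, y⟫_𝕜) : x = y :=
  b.repr.injective <| lp.ext <| funext fun a => by simpa only [b.repr_apply_apply] using h a

theorem exists_linearIsometryEquiv_apply_basis [CompleteSpace F] (b : HilbertBasis α 𝕜 E)
    (c : HilbertBasis β 𝕜 F) (σ : α ≃ β) : ∃ U : E ≃ₗᵢ[𝕜] F, ∀ a, U (b a) = c (σ a) := by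
  classical
  have hdense : ⊤ ≤ (Submodule.span 𝕜 (Set.range (c ∘ σ))).topologicalClosure := by
    rw [EquivLike.range_comp, c.dense_span]
  let c' := HilbertBasis.mk (c.orthonormal.comp σ σ.injective) hdense
  refine ⟨b.repr.trans c'.repr.symm, fun a => ?_⟩
  rw [LinearIsometryEquiv.trans_apply, b.repr_self, c'.repr_symm_single]
  simp only [c', HilbertBasis.coe_mk, Function.comp_apply]

end HilbertBasis

section ZeroExtend

variable {G 𝕜 H : Type*} [RCLike 𝕜] [NormedAddCommGroup H] [InnerProductSpace 𝕜 H] {Γ : Set G}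

/-- The family indexed by all of `G` that agrees with the basis `b` on `Γ` and vanishes
elsewhere. With it, matrix entries at `(g + γ, g)` make sense for every `γ`, whether or not
`g + γ` belongs to the index set. -/
noncomputable def zeroExtend (b : HilbertBasis Γ 𝕜 H) : G → H :=
  Function.extend Subtype.val b fun _ => (0 : H)

theorem zeroExtend_coe (b : HilbertBasis Γ 𝕜 H) (g : Γ) : zeroExtend b g = b g :=
  Subtype.val_injective.extend_apply b _ g

theorem zeroExtend_of_notMem (b : HilbertBasis Γ 𝕜 H) {g : G} (hg : g ∉ Γ) :
    zeroExtend b g = (0 : H) :=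
  Function.extend_apply' b _ g fun ⟨h, hh⟩ => hg (hh ▸ h.2)

theorem inner_zeroExtend_basis [DecidableEq G] (b : HilbertBasis Γ 𝕜 H) (g : G) (h : Γ) :
    ⟪zeroExtend b g, b h⟫_𝕜 = if g = h then 1 else 0 := by
  by_cases hg : g ∈ Γ
  · lift g to Γ using hg
    simp only [zeroExtend_coe, orthonormal_iff_ite.1 b.orthonormal g h, Subtype.coe_inj]
  · have hgh : g ≠ h := fun hgh => hg (hgh ▸ h.2)
    rw [zeroExtend_of_notMem b hg, inner_zero_left, if_neg hgh]

end ZeroExtend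

namespace CommutingIsometries

variable {ι G H K : Type*} [AddCommGroup G] [NormedAddCommGroup H] [InnerProductSpace ℂ H]
  [NormedAddCommGroup K] [InnerProductSpace ℂ K] {Γ Γ' : Set G}
  {V : CommutingIsometries ι H} {W : CommutingIsometries ι K} {s : ι → G}
  {b : HilbertBasis Γ ℂ H} {c : HilbertBasis Γ' ℂ K}

/-- `V` acts on the basis `b`, indexed by a subset `Γ` of an abelian group, by translations: the
`i`-th isometry moves the basis vector at `g` to the one at `g + s i`. -/
structure IsTranslation (V : CommutingIsometries ι H) (b : HilbertBasis Γ ℂ H) (s : ι → G) :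
    Prop where
  add_mem (i : ι) {g : G} (hg : g ∈ Γ) : g + s i ∈ Γ
  op_basis (i : ι) (g : Γ) : V.op i (b g) = b ⟨g + s i, add_mem i g.2⟩

namespace IsTranslation

theorem op_zeroExtend (hV : V.IsTranslation b s) (i : ι) {g : G} (hg : g ∈ Γ) :
    V.op i (zeroExtend b g) = zeroExtend b (g + s i) := by
  lift g to Γ using hg
  rw [zeroExtend_coe, hV.op_basis, ← zeroExtend_coe]

theorem inner_zeroExtend_op (hV : V.IsTranslation b s) (i : ι) (g : G) (x : H) :
    ⟪zeroExtend b (g + s i), V.op i x⟫_ℂ = ⟪zeroExtend b g, x⟫_ℂ := by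
  have h : (innerSL ℂ (zeroExtend b (g + s i))).comp (V.op i).toContinuousLinearMap =
      innerSL ℂ (zeroExtend b g) := by
    refine ext_hilbertBasis b fun h => ?_
    classical
    simp [hV.op_basis, inner_zeroExtend_basis]
  exact DFunLike.congr_fun h x

theorem inner_apply_eq_of_intertwines (hs : AddSubgroup.closure (Set.range s) = ⊤)
    (hV : V.IsTranslation b s) (hW : W.IsTranslation c s) {A : H →L[ℂ] K}
    (hA : V.Intertwines W A) (γ : G) {g h : G} (hg : g ∈ Γ) (hh : h ∈ Γ) :
    ⟪zeroExtend c (g + γ), A (zeroExtend b g)⟫_ℂ =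
      ⟪zeroExtend c (h + γ), A (zeroExtend b h)⟫_ℂ := by
  refine eq_of_forall_add_eq hs (F := fun g => ⟪zeroExtend c (g + γ), A (zeroExtend b g)⟫_ℂ)
    (Set.forall_mem_range.2 fun i g => hV.add_mem i) (Set.forall_mem_range.2 fun i g hg => ?_)
    hg hh
  rw [← hV.op_zeroExtend i hg, hA, add_right_comm, hW.inner_zeroExtend_op]

theorem add_mem_of_inner_ne_zero (hs : AddSubgroup.closure (Set.range s) = ⊤)
    (hV : V.IsTranslation b s) (hW : W.IsTranslation c s) {A : H →L[ℂ] K}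
    (hA : V.Intertwines W A) {γ g h : G} (hg : g ∈ Γ)
    (hne : ⟪zeroExtend c (g + γ), A (zeroExtend b g)⟫_ℂ ≠ 0) (hh : h ∈ Γ) : h + γ ∈ Γ' := by
  rw [hV.inner_apply_eq_of_intertwines hs hW hA γ hg hh] at hne
  by_contra hmem
  rw [zeroExtend_of_notMem c hmem, inner_zero_left] at hne
  exact hne rfl

theorem exists_intertwines_unitary [CompleteSpace K] (hV : V.IsTranslation b s)
    (hW : W.IsTranslation c s) {γ : G} (hγ : Γ' = (fun g => g + γ) '' Γ) :
    ∃ U : H ≃ₗᵢ[ℂ] K, V.Intertwines W U ∧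
      ∀ g ∈ Γ, U (zeroExtend b g) = zeroExtend c (g + γ) := by
  rw [eq_image_add_right_iff] at hγ
  obtain ⟨U, hU⟩ := exists_linearIsometryEquiv_apply_basis b c
    ((Equiv.addRight γ).subtypeEquiv fun g => (hγ g).symm)
  have hUb : ∀ g ∈ Γ, U (zeroExtend b g) = zeroExtend c (g + γ) := fun g hg => by
    lift g to Γ using hg
    rw [zeroExtend_coe, hU, ← zeroExtend_coe]
    rfl
  have hUV : ∀ i (g : Γ), U (V.op i (b g)) = W.op i (U (b g)) := fun i g => by
    rw [← zeroExtend_coe, hV.op_zeroExtend i g.2, hUb g g.2, hUb _ (hV.add_mem i g.2),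
      hW.op_zeroExtend i ((hγ g).2 g.2), add_right_comm]
  exact ⟨U, fun i => DFunLike.congr_fun (ext_hilbertBasis b
    (A := (U : H →L[ℂ] K).comp (V.op i).toContinuousLinearMap)
    (B := (W.op i).toContinuousLinearMap.comp (U : H →L[ℂ] K)) (hUV i)), hUb⟩

variable [CompleteSpace H]

theorem eq_image_of_inner_ne_zero [CompleteSpace K] (hs : AddSubgroup.closure (Set.range s) = ⊤)
    (hV : V.IsTranslation b s) (hW : W.IsTranslation c s) {A : H →L[ℂ] K}
    (hA : V.Intertwines W A) (hA' : W.Intertwines V (A†)) {γ g : G} (hg : g ∈ Γ)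
    (hne : ⟪zeroExtend c (g + γ), A (zeroExtend b g)⟫_ℂ ≠ 0) :
    Γ' = (fun g => g + γ) '' Γ := by
  have hgγ : g + γ ∈ Γ' := hV.add_mem_of_inner_ne_zero hs hW hA hg hne hg
  have hne' : ⟪zeroExtend b (g + γ + -γ), (A†) (zeroExtend c (g + γ))⟫_ℂ ≠ 0 := by
    rwa [add_neg_cancel_right, A.adjoint_inner_right, ← inner_conj_symm, map_ne_zero]
  refine eq_image_add_right_iff.2 fun h =>
    ⟨fun hh => ?_, hV.add_mem_of_inner_ne_zero hs hW hA hg hne⟩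
  simpa only [add_neg_cancel_right] using hW.add_mem_of_inner_ne_zero hs hV hA' hgγ hne' hh

theorem unitarilyEquivalent_iff [CompleteSpace K] (hs : AddSubgroup.closure (Set.range s) = ⊤)
    (hΓ : Γ.Nonempty) (hV : V.IsTranslation b s) (hW : W.IsTranslation c s) :
    V.UnitarilyEquivalent W ↔ ∃ γ, Γ' = (fun g => g + γ) '' Γ := by
  refine ⟨fun ⟨U, hU⟩ => ?_, fun ⟨γ, hγ⟩ => ?_⟩
  · obtain ⟨g, hg⟩ := hΓ
    have hUg : U (zeroExtend b g) ≠ 0 := by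
      rw [zeroExtend_coe b ⟨g, hg⟩]
      exact U.map_eq_zero_iff.not.2 (b.orthonormal.ne_zero _)
    obtain ⟨h, hh⟩ : ∃ h : Γ', ⟪c h, U (zeroExtend b g)⟫_ℂ ≠ 0 := by
      by_contra! hzero
      exact hUg (ext_inner_hilbertBasis c fun h => by rw [hzero, inner_zero_right])
    refine ⟨h - g, hV.eq_image_of_inner_ne_zero hs hW (A := U) hU (intertwines_adjoint hU) hg ?_⟩
    rwa [add_sub_cancel, zeroExtend_coe]
  · obtain ⟨U, hU, -⟩ := hV.exists_intertwines_unitary hW hγ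
    exact ⟨U, hU⟩

theorem ne_image_of_isIrreducible (hΓ : Γ.Nonempty) (hV : V.IsTranslation b s)
    (hirr : V.IsIrreducible) {γ : G} (hγ : γ ≠ 0) : Γ ≠ (fun g => g + γ) '' Γ := by
  intro hΓγ
  obtain ⟨U, hU, hUb⟩ := hV.exists_intertwines_unitary hV hΓγ
  obtain ⟨z, hz⟩ : (U : H →L[ℂ] H) ∈ (⊥ : StarSubalgebra ℂ (H →L[ℂ] H)) :=
    hirr.commutant_eq_bot ▸ mem_commutant_iff.2 ⟨hU, intertwines_adjoint hU⟩
  obtain ⟨g, hg⟩ := hΓ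
  lift g to Γ using hg
  have hUg : U (b g) = z • b g := by
    rw [← LinearIsometryEquiv.coe_coe'', ← hz]
    rfl
  have hUg' : U (b g) = zeroExtend b (g + γ) := by rw [← zeroExtend_coe, hUb g g.2]
  have horth : ⟪U (b g), U (b g)⟫_ℂ = 0 := by
    classical
    nth_rewrite 2 [hUg]
    rw [hUg', inner_smul_right, inner_zeroExtend_basis, if_neg (add_ne_left.2 hγ), mul_zero]
  exact b.orthonormal.ne_zero g (U.map_eq_zero_iff.1 (inner_self_eq_zero.1 horth))

theorem isIrreducible_of_forall_ne_image (hs : AddSubgroup.closure (Set.range s) = ⊤)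
    (hV : V.IsTranslation b s) (hΓ : ∀ γ ≠ 0, Γ ≠ (fun g => g + γ) '' Γ) : V.IsIrreducible := by
  refine isIrreducible_of_commutant_eq_bot (eq_bot_iff.2 fun T hT => ?_)
  obtain ⟨hT, hT'⟩ := mem_commutant_iff.1 hT
  have hoff : ∀ g h : Γ, g ≠ h → ⟪b h, T (b g)⟫_ℂ = 0 := fun g h hgh => by
    by_contra hne
    refine hΓ (h - g) (sub_ne_zero.2 (Subtype.coe_injective.ne hgh.symm))
      (hV.eq_image_of_inner_ne_zero hs hV hT hT' g.2 ?_)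
    rwa [add_sub_cancel, zeroExtend_coe, zeroExtend_coe]
  have hdiag : ∀ g h : Γ, ⟪b g, T (b g)⟫_ℂ = ⟪b h, T (b h)⟫_ℂ := fun g h => by
    simpa only [add_zero, zeroExtend_coe] using
      hV.inner_apply_eq_of_intertwines hs hV hT 0 g.2 h.2
  obtain ⟨z, hz⟩ : ∃ z, ∀ g : Γ, ⟪b g, T (b g)⟫_ℂ = z := by
    rcases isEmpty_or_nonempty Γ with hempty | ⟨⟨g₀⟩⟩
    · exact ⟨0, isEmptyElim⟩
    · exact ⟨_, fun g => hdiag g g₀⟩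
  refine ⟨z, ext_hilbertBasis b fun g => ext_inner_hilbertBasis b fun h => ?_⟩
  change ⟪b h, z • b g⟫_ℂ = ⟪b h, T (b g)⟫_ℂ
  rcases eq_or_ne g h with rfl | hgh
  · rw [hz, inner_smul_right, inner_self_eq_norm_sq_to_K, b.orthonormal.1]
    simp
  · rw [hoff g h hgh, inner_smul_right, b.orthonormal.2 hgh.symm, mul_zero]

theorem isReducible_iff (hs : AddSubgroup.closure (Set.range s) = ⊤) (hΓ : Γ.Nonempty)
    (hV : V.IsTranslation b s) : V.IsReducible ↔ ∃ γ ≠ 0, Γ = (fun g => g + γ) '' Γ := by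
  refine ⟨fun hred => ?_, fun ⟨γ, hγ, hΓγ⟩ hirr => hV.ne_image_of_isIrreducible hΓ hirr hγ hΓγ⟩
  contrapose! hred
  exact not_not.2 (hV.isIrreducible_of_forall_ne_image hs hred)

end IsTranslation

end CommutingIsometries

/-! ### Closed spans of orthonormal families -/

section ClosedSpan

variable {G 𝕜 E : Type*} [RCLike 𝕜] [NormedAddCommGroup E] [InnerProductSpace 𝕜 E] {e : G → E}
  {Γ : Set G}

/-- The closed linear span of the vectors `e g`, `g ∈ Γ`; the space `H_Γ` when `e` is the family of
monomials on the torus. -/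
abbrev closedSpan (𝕜 : Type*) {G E : Type*} [RCLike 𝕜] [NormedAddCommGroup E]
    [InnerProductSpace 𝕜 E] (e : G → E) (Γ : Set G) : Submodule 𝕜 E :=
  (Submodule.span 𝕜 (e '' Γ)).topologicalClosure

theorem mem_closedSpan {g : G} (hg : g ∈ Γ) : e g ∈ closedSpan 𝕜 e Γ :=
  Submodule.le_topologicalClosure _ (Submodule.subset_span (Set.mem_image_of_mem e hg))

theorem inner_eq_zero_of_mem_closedSpan {x y : E} (hx : ∀ g ∈ Γ, ⟪x, e g⟫_𝕜 = 0)
    (hy : y ∈ closedSpan 𝕜 e Γ) : ⟪x, y⟫_𝕜 = 0 := by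
  have hle : closedSpan 𝕜 e Γ ≤ (𝕜 ∙ x)ᗮ := by
    refine Submodule.topologicalClosure_minimal _ (Submodule.span_le.2 ?_)
      (Submodule.isClosed_orthogonal _)
    rintro _ ⟨g, hg, rfl⟩
    exact Submodule.mem_orthogonal_singleton_iff_inner_right.2 (hx g hg)
  exact Submodule.mem_orthogonal_singleton_iff_inner_right.1 (hle hy)

theorem mem_closedSpan_iff (he : Orthonormal 𝕜 e) {g : G} : e g ∈ closedSpan 𝕜 e Γ ↔ g ∈ Γ := by
  refine ⟨fun h => by_contra fun hg => he.ne_zero g ?_, mem_closedSpan⟩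
  have horth : ∀ h ∈ Γ, ⟪e g, e h⟫_𝕜 = 0 := fun h hh =>
    he.2 (ne_of_mem_of_not_mem hh hg).symm
  exact inner_self_eq_zero.1 (inner_eq_zero_of_mem_closedSpan horth h)

variable [CompleteSpace E]

/-- The vectors `e g`, `g ∈ Γ`, of an orthonormal family as a Hilbert basis of their closed linear
span. -/
noncomputable def closedSpanBasis (he : Orthonormal 𝕜 e) (Γ : Set G) :
    HilbertBasis Γ 𝕜 (closedSpan 𝕜 e Γ) :=
  HilbertBasis.mkOfOrthogonalEqBot
    (v := fun g : Γ => (⟨e g, mem_closedSpan g.2⟩ : closedSpan 𝕜 e Γ))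
    ((closedSpan 𝕜 e Γ).subtypeₗᵢ.orthonormal_comp_iff.1 (he.comp _ Subtype.val_injective)) <| by
    refine (Submodule.eq_bot_iff _).2 fun x hx => ?_
    have hxe : ∀ g ∈ Γ, ⟪(x : E), e g⟫_𝕜 = 0 := fun g hg =>
      (Submodule.mem_orthogonal' _ x).1 hx _ (Submodule.subset_span ⟨⟨g, hg⟩, rfl⟩)
    exact Subtype.ext (inner_self_eq_zero.1 (inner_eq_zero_of_mem_closedSpan hxe x.2))

theorem coe_closedSpanBasis (he : Orthonormal 𝕜 e) (g : Γ) :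
    (closedSpanBasis he Γ g : E) = e g := by
  rw [closedSpanBasis, HilbertBasis.coe_mkOfOrthogonalEqBot]

end ClosedSpan

theorem isTranslation_restrict {ι G E : Type*} [AddCommGroup G] [NormedAddCommGroup E]
    [InnerProductSpace ℂ E] [CompleteSpace E] {e : G → E} {Γ : Set G}
    {V : CommutingIsometries ι E} {s : ι → G} (he : Orthonormal ℂ e)
    (hV : ∀ i g, V.op i (e g) = e (g + s i)) (hΓ : V.IsInvariant (closedSpan ℂ e Γ)) :
    (V.restrict _ hΓ).IsTranslation (closedSpanBasis he Γ) s where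
  add_mem i g hg := by
    rw [← mem_closedSpan_iff he] at hg ⊢
    exact hV i g ▸ hΓ i _ hg
  op_basis i g := Subtype.ext <| by
    rw [coe_closedSpanBasis, ← hV, ← coe_closedSpanBasis he]
    rfl

/-! ### Monomials on the torus -/

theorem orthonormal_torusBasisVec : Orthonormal ℂ torusBasisVec := by
  have hmonomial (g : ℤ × ℤ) : torusMonomial g = UnitAddTorus.mFourier ![g.1, g.2] := by
    ext x
    simp [torusMonomial, UnitAddTorus.mFourier, torusCoord, fourier_apply,
      AddCircle.toCircle_zsmul]
  have hcomp : torusBasisVec =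
      (UnitAddTorus.mFourierLp (d := Fin 2) 2) ∘ (finTwoArrowEquiv ℤ).symm :=
    funext fun g => congrArg (ContinuousMap.toLp 2 torusMeasure ℂ) (hmonomial g)
  rw [hcomp]
  exact UnitAddTorus.orthonormal_mFourier.comp _ (Equiv.injective _)

/-- The exponents of the two coordinate functions: multiplication by `ζ_k` translates the
exponent of a monomial by `coordStep k`. -/
def coordStep : Fin 2 → ℤ × ℤ := ![(1, 0), (0, 1)]

theorem closure_range_coordStep : AddSubgroup.closure (Set.range coordStep) = ⊤ := by
  refine eq_top_iff.2 fun g _ => ?_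
  have hg : g = g.1 • coordStep 0 + g.2 • coordStep 1 := by ext <;> simp [coordStep]
  have hmem (k : Fin 2) : coordStep k ∈ AddSubgroup.closure (Set.range coordStep) :=
    AddSubgroup.subset_closure (Set.mem_range_self k)
  rw [hg]
  exact add_mem (zsmul_mem (hmem 0) _) (zsmul_mem (hmem 1) _)

theorem torusMonomial_add (g h : ℤ × ℤ) (x : Torus2) :
    torusMonomial (g + h) x = torusMonomial g x * torusMonomial h x := by
  simp only [torusMonomial, ContinuousMap.coe_mk, Prod.fst_add, Prod.snd_add,
    zpow_add₀ (Circle.coe_ne_zero _)]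
  ring

theorem torusMonomial_coordStep (k : Fin 2) (x : Torus2) :
    torusMonomial (coordStep k) x = torusCoord k x := by
  fin_cases k <;> simp [torusMonomial, coordStep]

theorem coordMul_torusBasisVec (k : Fin 2) (g : ℤ × ℤ) :
    coordMul k (torusBasisVec g) = torusBasisVec (g + coordStep k) := by
  apply Lp.ext
  filter_upwards [coordMul_coeFn k (torusBasisVec g),
    ContinuousMap.coeFn_toLp (p := 2) (𝕜 := ℂ) torusMeasure (torusMonomial g),
    ContinuousMap.coeFn_toLp (p := 2) (𝕜 := ℂ) torusMeasure (torusMonomial (g + coordStep k))]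
    with x hmul hg hgk
  rw [hmul, torusBasisVec, torusBasisVec, hg, hgk, torusMonomial_add,
    torusMonomial_coordStep, mul_comm]

theorem corollary8p5_general {ι G H K : Type*} [AddCommGroup G]
    [NormedAddCommGroup H] [InnerProductSpace ℂ H] [CompleteSpace H]
    [NormedAddCommGroup K] [InnerProductSpace ℂ K] [CompleteSpace K] {Γ Γ' : Set G}
    {V : CommutingIsometries ι H} {W : CommutingIsometries ι K} {s : ι → G}
    {b : HilbertBasis Γ ℂ H} {c : HilbertBasis Γ' ℂ K}
    (hs : AddSubgroup.closure (Set.range s) = ⊤) (hΓ : Γ.Nonempty)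
    (hV : V.IsTranslation b s) (hW : W.IsTranslation c s) :
    (V.UnitarilyEquivalent W ↔ ∃ γ, Γ' = (fun g => g + γ) '' Γ) ∧
      (V.IsReducible ↔ ∃ γ, γ ≠ 0 ∧ Γ = (fun g => g + γ) '' Γ) :=
  ⟨hV.unitarilyEquivalent_iff hs hΓ hW, hV.isReducible_iff hs hΓ⟩

theorem corollary8p5 (Γ Γ' : Set (ℤ × ℤ))
    (hne : Γ.Nonempty) (hproper : Γ ≠ Set.univ)
    (hne' : Γ'.Nonempty) (hproper' : Γ' ≠ Set.univ)
    (hinv : coordBiIsometry.IsInvariant (spanSpace Γ))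
    (hinv' : coordBiIsometry.IsInvariant (spanSpace Γ')) :
    ((coordBiIsometry.restrict (spanSpace Γ) hinv).UnitarilyEquivalent
        (coordBiIsometry.restrict (spanSpace Γ') hinv') ↔
      ∃ γ : ℤ × ℤ, Γ' = (fun g => g + γ) '' Γ) ∧
    ((coordBiIsometry.restrict (spanSpace Γ) hinv).IsReducible ↔
      ∃ γ : ℤ × ℤ, γ ≠ 0 ∧ Γ = (fun g => g + γ) '' Γ) :=
  corollary8p5_general (H := closedSpan ℂ torusBasisVec Γ) (K := closedSpan ℂ torusBasisVec Γ')
    closure_range_coordStep hne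
    (isTranslation_restrict orthonormal_torusBasisVec coordMul_torusBasisVec hinv)
    (isTranslation_restrict orthonormal_torusBasisVec coordMul_torusBasisVec hinv')
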